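/- Let $D\subset\mathbb{R}^2$ be a connected, reduced, checkerboard-colored link diagram with at least one crossing (reduced means that no crossing meets a region of $D$ more than once; checkerboard-colored means that the regions are colored black and white so that the colors alternate around every crossing). Let $G$ be its Tait graph: the plane graph whose vertices are the black regions of $D$ and whose edges are the crossings, each crossing joining the two black regions that meet there; an edge is labelled $+$ if the A-resolution of its crossing merges the two black regions at this crossing, and $-$ if it merges the two white regions. Let $\sigma$ be a state of $D$, that is, a choice of an A- or a B-resolution at each crossing. Resolving all crossings gives a collection of disjoint state circles, together with one state segment (an A-segment or a B-segment) for each crossing, recording where it was resolved. The diagram $D$ is $\sigma$-adequate if no state segment connects a state circle to itself. It is $\sigma$-homogeneous if no connected component of the complement of the state circles contains both A-segments and B-segments. It is homogeneously adequate with respect to $\sigma$ if it is both. Let $E_\sigma\subseteq E(G)$ consist of the $+$ edges whose crossings are A-resolved and the $-$ edges whose crossings are B-resolved by $\sigma$, let $\overline{E_\sigma}=E(G)\setminus E_\sigma$, and let $G|E_\sigma$ be the spanning subgraph of $G$ with edge set $E_\sigma$. A fundamental cycle of $G|E_\sigma$ is the boundary of a bounded face of the plane graph $G|E_\sigma$,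 and the edges of $\overline{E_\sigma}$ inside it are those lying in that face. Then $D$ is homogeneously adequate with respect to $\sigma$ if and only if the partition $E(G)=E_\sigma\sqcup\overline{E_\sigma}$ satisfies all of the following conditions. 1. Every edge of $E_\sigma$ is contained in a cycle of $G|E_\sigma$. 2. No edge of $\overline{E_\sigma}$ has both endpoints on one connected component of $G|E_\sigma$. 3. The edges of each connected component of $G|E_\sigma$ are all $+$ edges or all $-$ edges. 4. For each fundamental cycle of $G|E_\sigma$, the edges of $\overline{E_\sigma}$ inside it are all $+$ edges or all $-$ edges. 5. The edges of $\overline{E_\sigma}$ in the unbounded face of $G|E_\sigma$ are all $+$ edges or all $-$ edges. -/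

import Mathlib

/-! ## Multigraphs

Mathlib's `Graph V E` (multigraphs with loops and parallel edges) and its edge restriction
`G.restrict H` (same vertices, only the edges in `H`) are used.  Cycles and connected components
are added here. -/

namespace TaitGraph

/-- The vertices `v 0, …, v n` and the edges `e 0, …, e n` form a cycle of `G`: all vertices are
distinct, all edges are distinct, and `e i` joins `v i` to `v (i + 1)`, the indices being read
cyclically.  For `n = 0` this is a loop, for `n = 1` a pair of parallel edges. -/
structure IsCycle {V E : Type*} (G : Graph V E) (n : ℕ)
    (v : Fin (n + 1) → V) (e : Fin (n + 1) → E) : Prop where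
  vertices_distinct : Function.Injective v
  edges_distinct : Function.Injective e
  isLink : ∀ i, G.IsLink (e i) (v i) (v (i + 1))

/-- The edge `x` is contained in a cycle of `G`. -/
def InCycle {V E : Type*} (G : Graph V E) (x : E) : Prop :=
  ∃ (n : ℕ) (v : Fin (n + 1) → V) (e : Fin (n + 1) → E), IsCycle G n v e ∧ ∃ i, e i = x

/-- `S` is the vertex set of a connected component of `G`. -/
def IsComponent {V E : Type*} (G : Graph V E) (S : Set V) : Prop :=
  ∃ x ∈ G.vertexSet, S = {y | Relation.ReflTransGen G.Adj x y}

end TaitGraph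

/-! ## Link diagrams -/

/-- The combinatorial data of a 4-valent graph drawn on an oriented surface, with over/under
information at its vertices (the content of a planar diagram code).  `C` is the set of crossings.
Each crossing `c` has four ends `(c, 0), (c, 1), (c, 2), (c, 3)`, listed counterclockwise; `(c, 0)`
and `(c, 2)` are the ends of the strand passing under, `(c, 1)` and `(c, 3)` those of the strand
passing over.  `opp` matches the two ends of each edge of the projection graph. -/
structure CrossingMap (C : Type*) where
  opp : Equiv.Perm (C × ZMod 4)
  opp_opp : ∀ d, opp (opp d) = d
  opp_ne : ∀ d, opp d ≠ d

namespace CrossingMap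

variable {C : Type*}

/-- The counterclockwise rotation of the ends at each crossing. -/
def rot : Equiv.Perm (C × ZMod 4) :=
  Equiv.prodCongr (Equiv.refl C) (Equiv.addRight (1 : ZMod 4))

/-- Walking around a region.  An end `(c, i)` also stands for the corner at `c` between the ends
`(c, i)` and `(c, i + 1)`, that is, for the left side of the edge that leaves `c` along `(c, i)`.
Walking along this edge with its left side on the left, the next corner of the same region is the
one just clockwise of the end at which the edge arrives. -/
def facePerm (M : CrossingMap C) : Equiv.Perm (C × ZMod 4) :=
  M.opp.trans rot.symm

/-- The regions: cyclic sequences of corners obtained by walking around a face. -/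
def Region (M : CrossingMap C) : Type _ :=
  Quotient (Equiv.Perm.SameCycle.setoid M.facePerm)

/-- The region containing the corner between the ends `(c, i)` and `(c, i + 1)`; it is the region to
the left of the edge that leaves `c` along `(c, i)`. -/
def region (M : CrossingMap C) (d : C × ZMod 4) : M.Region :=
  Quotient.mk (Equiv.Perm.SameCycle.setoid M.facePerm) d

/-- Two crossings are joined by an edge of the projection graph. -/
def Joined (M : CrossingMap C) (c c' : C) : Prop :=
  ∃ i j : ZMod 4, M.opp (c, i) = (c', j)

end CrossingMap

/-- A connected link diagram in the plane with (finite) set of crossings `C`; the condition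
`planar` forces at least one crossing.  Planarity of the drawing is Euler's formula
`|C| - 2 |C| + (number of regions) = 2` for the connected 4-valent projection graph, which has
`2 |C|` edges; it makes the underlying surface a sphere, that is, the plane with a point at infinity,
and `unbounded` is the region containing that point. -/
structure ConnectedLinkDiagram (C : Type*) extends CrossingMap C where
  finite : Finite C
  connected : ∀ c c' : C, Relation.ReflTransGen toCrossingMap.Joined c c'
  planar : Nat.card toCrossingMap.Region = Nat.card C + 2
  unbounded : toCrossingMap.Region

/-- The two ways of resolving a crossing. -/
inductive Resolution
  | A
  | B

/-- The two labels of the edges of a Tait graph. -/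
inductive EdgeSign
  | plus
  | minus

namespace ConnectedLinkDiagram

variable {C : Type*}

/-- A crossing is nugatory if it meets some region more than once. -/
def IsNugatory (D : ConnectedLinkDiagram C) (c : C) : Prop :=
  ∃ i j : ZMod 4, i ≠ j ∧ D.region (c, i) = D.region (c, j)

/-- A diagram is reduced if it has no nugatory crossing. -/
def IsReduced (D : ConnectedLinkDiagram C) : Prop :=
  ∀ c, ¬ D.IsNugatory c

/-! ### States, state circles, state segments -/

/-- A state chooses a resolution of each crossing. -/
abbrev State (_D : ConnectedLinkDiagram C) : Type _ := C → Resolution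

/-- How the four ends at a crossing are connected after resolving it.  The A-resolution opens a
channel between the two opposite regions swept out when the over-strand is turned counterclockwise
onto the under-strand, which are those at the corners 1 and 3: it connects the ends 0, 1 and the ends
2, 3.  The B-resolution opens a channel between the regions at the corners 0 and 2: it connects the
ends 1, 2 and the ends 3, 0. -/
def partner : Resolution → ZMod 4 → ZMod 4
  | .A, i => 1 - i
  | .B, i => 3 - i

/-- One of the two opposite corners between which the resolution opens its channel; the other one
is `channel r + 2`.  The state segment crosses this channel from one of its sides to the other. -/
def channel : Resolution → ZMod 4
  | .A => 1
  | .B => 0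

/-- Two ends are consecutive on a state circle: they belong to the same edge of the projection graph,
or they are connected by the resolution of a crossing. -/
def CircleStep (D : ConnectedLinkDiagram C) (σ : D.State) (d d' : C × ZMod 4) : Prop :=
  d' = D.opp d ∨ d' = (d.1, partner (σ d.1) d.2)

/-- The state circles of `σ`: the classes of ends under the equivalence relation generated by
`CircleStep`. -/
def StateCircle (D : ConnectedLinkDiagram C) (σ : D.State) : Type _ :=
  Quot (D.CircleStep σ)

/-- The state circle running through an end. -/
def circle (D : ConnectedLinkDiagram C) (σ : D.State) (d : C × ZMod 4) : D.StateCircle σ :=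
  Quot.mk _ d

/-- `D` is `σ`-adequate if no state segment connects a state circle to itself.  In either resolution
of `c` the two arcs joined by the state segment at `c` run through `(c, 0)` and `(c, 2)`. -/
def IsAdequate (D : ConnectedLinkDiagram C) (σ : D.State) : Prop :=
  ∀ c, D.circle σ (c, 0) ≠ D.circle σ (c, 2)

/-- Two regions of `D` are merged by the channel which `σ` opens at some crossing. -/
def Merged (D : ConnectedLinkDiagram C) (σ : D.State) (r r' : D.Region) : Prop :=
  ∃ c, r = D.region (c, channel (σ c)) ∧ r' = D.region (c, channel (σ c) + 2)

/-- The complementary regions of the collection of state circles of `σ`.  The complement of the state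
circles consists of the regions of `D` together with one channel at each crossing, which joins two
opposite regions; its connected components are thus the classes of regions of `D` under the
equivalence relation generated by `Merged`. -/
def ComplementaryRegion (D : ConnectedLinkDiagram C) (σ : D.State) : Type _ :=
  Quot (D.Merged σ)

/-- The complementary region of the state circles that contains the state segment at `c`. -/
def segmentRegion (D : ConnectedLinkDiagram C) (σ : D.State) (c : C) : D.ComplementaryRegion σ :=
  Quot.mk _ (D.region (c, channel (σ c)))

/-- `D` is `σ`-homogeneous if no complementary region of the state circles contains both
A-segments and B-segments. -/
def IsHomogeneous (D : ConnectedLinkDiagram C) (σ : D.State) : Prop :=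
  ¬ ∃ (R : D.ComplementaryRegion σ) (c c' : C),
    D.segmentRegion σ c = R ∧ D.segmentRegion σ c' = R ∧ σ c = .A ∧ σ c' = .B

/-- `D` is homogeneously adequate with respect to `σ`. -/
def IsHomogeneouslyAdequate (D : ConnectedLinkDiagram C) (σ : D.State) : Prop :=
  D.IsAdequate σ ∧ D.IsHomogeneous σ

/-! ### Checkerboard colorings and Tait graphs -/

/-- A checkerboard coloring: around each crossing the colors black and white alternate. -/
structure Coloring (D : ConnectedLinkDiagram C) where
  black : D.Region → Prop
  alternates : ∀ (c : C) (i : ZMod 4), black (D.region (c, i + 1)) ↔ ¬ black (D.region (c, i))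

namespace Coloring

variable {D : ConnectedLinkDiagram C}

/-- The coloring with black and white exchanged. -/
def swap (κ : D.Coloring) : D.Coloring where
  black r := ¬ κ.black r
  alternates c i := not_congr (κ.alternates c i)

theorem black_add_two (κ : D.Coloring) (c : C) (i : ZMod 4) :
    κ.black (D.region (c, i + 2)) ↔ κ.black (D.region (c, i)) := by
  have h : i + 2 = i + 1 + 1 := by ring
  rw [h, κ.alternates, κ.alternates, not_not]

/-- Two black corners at the same crossing are equal or opposite. -/
theorem eq_or_eq_add_two (κ : D.Coloring) {c : C} {i j : ZMod 4}
    (hi : κ.black (D.region (c, i))) (hj : κ.black (D.region (c, j))) : j = i ∨ j = i + 2 := by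
  have key : ∀ i j : ZMod 4, j = i ∨ j = i + 1 ∨ j = i + 2 ∨ i = j + 1 := by decide
  rcases key i j with h | h | h | h
  · exact Or.inl h
  · subst h
    exact absurd hi ((κ.alternates c i).1 hj)
  · exact Or.inr h
  · subst h
    exact absurd hj ((κ.alternates c j).1 hi)

theorem add_two_add_two (i : ZMod 4) : i + 2 + 2 = i := by
  revert i
  decide

/-- The Tait graph: its vertices are the black regions, its edges are the crossings, and the edge `c`
joins the two (possibly equal) black regions at the opposite black corners of `c`. -/
def tait (κ : D.Coloring) : Graph D.Region C where
  vertexSet := {r | κ.black r}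
  IsLink c r r' := ∃ i : ZMod 4, κ.black (D.region (c, i)) ∧
    r = D.region (c, i) ∧ r' = D.region (c, i + 2)
  edgeSet := Set.univ
  isLink_symm := by
    intro c _
    refine ⟨?_⟩
    rintro r r' ⟨i, hi, rfl, rfl⟩
    exact ⟨i + 2, (κ.black_add_two c i).2 hi, rfl, by rw [add_two_add_two]⟩
  eq_or_eq_of_isLink_of_isLink := by
    rintro c x y v w ⟨i, hi, rfl, rfl⟩ ⟨j, hj, rfl, rfl⟩
    rcases κ.eq_or_eq_add_two hj hi with h | h
    · exact Or.inl (by rw [h])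
    · exact Or.inr (by rw [h])
  edge_mem_iff_exists_isLink := by
    intro c
    refine ⟨fun _ => ?_, fun _ => Set.mem_univ c⟩
    by_cases h : κ.black (D.region (c, 0))
    · exact ⟨_, _, 0, h, rfl, rfl⟩
    · exact ⟨_, _, 0 + 1, (κ.alternates c 0).2 h, rfl, rfl⟩
  left_mem_of_isLink := by
    rintro c x y ⟨i, hi, rfl, rfl⟩
    exact hi

/-- The planar dual of the Tait graph, that is, the Tait graph of the opposite coloring: its
vertices, the white regions, are the faces of the Tait graph, and the edge `c` joins the faces on the
two sides of the edge `c` of the Tait graph. -/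
def dual (κ : D.Coloring) : Graph D.Region C := κ.swap.tait

open Classical in
/-- The label of an edge of the Tait graph.  It is `+` if the A-resolution of the crossing opens its
channel between the two black corners, and `-` if it opens it between the two white corners. -/
noncomputable def sign (κ : D.Coloring) (c : C) : EdgeSign :=
  if κ.black (D.region (c, channel .A)) then .plus else .minus

/-- The edge set `E_σ`: the `+` edges whose crossings are A-resolved and the `-` edges whose crossings
are B-resolved. -/
def edgesOf (κ : D.Coloring) (σ : D.State) : Set C :=
  {c | (κ.sign c = .plus ∧ σ c = .A) ∨ (κ.sign c = .minus ∧ σ c = .B)}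

/-- The edges in `S` are all `+` edges or all `-` edges. -/
def SingleSigned (κ : D.Coloring) (S : Set C) : Prop :=
  (∀ c ∈ S, κ.sign c = .plus) ∨ (∀ c ∈ S, κ.sign c = .minus)

/-- The faces (complementary regions in the plane) of the subgraph `G|H` of the plane graph
`G = κ.tait`.  Deleting an edge of `G` merges the faces on its two sides, so a face of `G|H` consists
of faces of `G` (white regions) glued along edges outside `H`; it is given by its set of white
regions. -/
def IsFace (κ : D.Coloring) (H : Set C) (F : Set D.Region) : Prop :=
  TaitGraph.IsComponent (κ.dual.restrict Hᶜ) F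

/-- The edges of `G` outside `H` that lie in the face `F` of `G|H`. -/
def edgesInside (κ : D.Coloring) (H : Set C) (F : Set D.Region) : Set C :=
  {c | c ∉ H ∧ ∃ r ∈ F, κ.dual.Inc c r}

/-- The white region `w` is the unbounded face of the Tait graph in a drawing of it in the plane.  If
the unbounded region of `D` is white, then `w` is that region.  If it is black, then the vertex of `G`
placed in it is drawn so that the point at infinity lies in one of the sectors at this vertex, and
`w` is the white region on the other side of the edge of `D` bounding this sector. -/
def IsUnboundedFace (κ : D.Coloring) (w : D.Region) : Prop :=
  ¬ κ.black w ∧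
    (w = D.unbounded ∨ ∃ d, D.region d = D.unbounded ∧ D.region (D.opp d) = w)

end Coloring

end ConnectedLinkDiagram

/-! A crossing lies in `edgesOf σ` exactly when its resolution opens the channel between its two
black corners (`mem_edgesOf`). Exchanging the colours therefore replaces G by its planar dual and
`E_σ` by its complement, so facts about components of `G|E_σ` become facts about its faces.

Adequacy is checked crossing by crossing. Along a state circle the black side stays in one component
of `G|E_σ` (`conn_blackSide_of_circle_eq`), and the white side in one component of the dual
restricted to the complement. A parity count (`conn_of_circle_ne`) shows that a segment in `E_σ`
joining different circles is not a bridge of `G|E_σ`. The remaining implications follow from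
`not_conn_of_conn_swap`: a black and a white closed curve cannot meet in exactly one crossing. That
rests on linear algebra modulo 2: the coboundary spaces of G and its dual are orthogonal, and
Euler's formula makes them complementary in dimension, so each is the full annihilator of the other.

Homogeneity needs no planarity. Channels join regions of one colour, so the complementary regions of
the state circles are the components of `G|E_σ` and the faces of `G|E_σ`. On `E_σ` the sign + means
an A-resolution, off `E_σ` a B-resolution, so unmixed segments mean single-signed edges. -/

namespace TaitGraph

/-! ### Cycles and bridges in multigraphs. -/

variable {V E : Type*}

open Fin.NatCast Fin.CommRing in
theorem reflTransGen_restrict_of_isCycle {G : Graph V E} {n : ℕ} {v : Fin (n + 1) → V}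
    {e : Fin (n + 1) → E} (h : IsCycle G n v e) (i : Fin (n + 1)) :
    Relation.ReflTransGen (G.restrict {e i}ᶜ).Adj (v (i + 1)) (v i) := by
  have key : ∀ k : ℕ, k ≤ n → Relation.ReflTransGen (G.restrict {e i}ᶜ).Adj (v (i + 1))
      (v (i + 1 + (k : Fin (n + 1)))) := by
    intro k
    induction k with
    | zero => intro _; simpa using Relation.ReflTransGen.refl
    | succ k ih =>
      intro hk
      refine (ih (by omega)).tail ⟨e (i + 1 + (k : Fin (n + 1))), ?_⟩
      rw [Graph.restrict_isLink]
      have hne : e (i + 1 + (k : Fin (n + 1))) ∈ ({e i}ᶜ : Set E) := by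
        intro hmem
        have h1 := h.edges_distinct hmem
        -- Going round from `v (i + 1)`, the edge `e i` could recur only if `n + 1` divided `k + 1`,
        -- which is at most `n`.
        have h2 : ((k + 1 : ℕ) : Fin (n + 1)) = 0 := by
          have : i + (1 + (k : Fin (n + 1))) = i + 0 := by rw [← add_assoc, h1, add_zero]
          rw [Nat.cast_add, Nat.cast_one, add_comm (k : Fin (n + 1))]
          exact add_left_cancel this
        rw [Fin.natCast_eq_zero] at h2
        exact absurd (Nat.le_of_dvd (Nat.succ_pos k) h2) (by omega)
      have hl := h.isLink (i + 1 + (k : Fin (n + 1)))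
      have heq : i + 1 + (k : Fin (n + 1)) + 1 = i + 1 + ((k + 1 : ℕ) : Fin (n + 1)) := by
        rw [Nat.cast_add, Nat.cast_one, add_assoc]
      rw [heq] at hl
      exact ⟨hne, hl⟩
  have h3 : i + 1 + (n : Fin (n + 1)) = i := by
    have : ((n + 1 : ℕ) : Fin (n + 1)) = 0 := by rw [Fin.natCast_eq_zero]
    rw [Nat.cast_add, Nat.cast_one] at this
    rw [add_assoc, add_comm 1, this, add_zero]
  have := key n le_rfl
  rwa [h3] at this

/-- Two vertices connected by a walk are connected by a path with distinct vertices. -/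
theorem exists_injective_of_reflTransGen {r : V → V → Prop} (hr : ∀ x y, r x y → r y x)
    {x y : V} (h : Relation.ReflTransGen r x y) :
    ∃ (n : ℕ) (v : Fin (n + 1) → V), Function.Injective v ∧ v 0 = x ∧ v (Fin.last n) = y ∧
      ∀ i : Fin n, r (v i.castSucc) (v i.succ) := by
  classical
  let S : SimpleGraph V :=
    { Adj := fun a b => a ≠ b ∧ r a b
      symm := ⟨fun a b hab => ⟨hab.1.symm, hr _ _ hab.2⟩⟩
      loopless := ⟨fun a ha => ha.1 rfl⟩ }
  have hreach : S.Reachable x y := by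
    induction h with
    | refl => exact SimpleGraph.Reachable.refl _
    | @tail b c _ hbc ih =>
      by_cases hb : b = c
      · exact hb ▸ ih
      · exact ih.trans (SimpleGraph.Adj.reachable (G := S) ⟨hb, hbc⟩)
  obtain ⟨p, hp⟩ := hreach.exists_isPath
  refine ⟨p.length, fun i => p.getVert i, ?_, by simp, by simp, ?_⟩
  · intro i j hij
    exact Fin.ext (hp.getVert_injOn (Nat.lt_succ_iff.1 i.2) (Nat.lt_succ_iff.1 j.2) hij)
  · intro i
    exact (p.adj_getVert_succ i.2).2

/-- A path with distinct vertices that avoids `c` is closed up by `c` as its last edge. Distinctness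
of the vertices forces distinctness of the edges; the path of length 0 gives a loop. -/
theorem inCycle_of_reflTransGen {G : Graph V E} {c : E} {x y : V} (hc : G.IsLink c x y)
    (h : Relation.ReflTransGen (G.restrict {c}ᶜ).Adj x y) : InCycle G c := by
  obtain ⟨n, v, hv, rfl, rfl, hadj⟩ :=
    exists_injective_of_reflTransGen (fun _ _ h => Graph.Adj.symm h) h
  choose f hf using hadj
  simp only [Graph.restrict_isLink] at hf
  have hfc : ∀ i, f i ≠ c := fun i hi => by simpa [hi] using hf i
  have hfl : ∀ i, G.IsLink (f i) (v i.castSucc) (v i.succ) := fun i => by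
    have := hf i; tauto
  refine ⟨n, v, Fin.lastCases c f, ⟨hv, ?_, ?_⟩, Fin.last n, by simp⟩
  · intro i j
    induction i using Fin.lastCases with
    | last =>
      induction j using Fin.lastCases with
      | last => simp
      | cast j => simpa using fun h => absurd h.symm (hfc j)
    | cast i =>
      induction j using Fin.lastCases with
      | last => simpa using fun h => absurd h (hfc i)
      | cast j =>
        simp only [Fin.lastCases_castSucc]
        intro hij
        have hj := hfl j
        rw [← hij] at hj
        rcases (hfl i).eq_and_eq_or_eq_and_eq hj with ⟨h1, _⟩ | ⟨h1, h2⟩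
        · exact hv h1
        -- An edge traversed in opposite directions would need both `i = j + 1` and `i + 1 = j`.
        · have h1 := congrArg Fin.val (hv h1)
          have h2 := congrArg Fin.val (hv h2)
          simp at h1 h2
          omega
  · intro i
    induction i using Fin.lastCases with
    | last => simpa using hc.symm
    | cast i => simpa using hfl i

/-- An edge lies on a cycle if and only if its ends remain connected when it is deleted. -/
theorem inCycle_iff {G : Graph V E} {c : E} {x y : V} (hc : G.IsLink c x y) :
    InCycle G c ↔ Relation.ReflTransGen (G.restrict {c}ᶜ).Adj x y := by
  refine ⟨?_, inCycle_of_reflTransGen hc⟩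
  rintro ⟨n, v, e, h, i, rfl⟩
  have hp := reflTransGen_restrict_of_isCycle h i
  rcases hc.eq_and_eq_or_eq_and_eq (h.isLink i) with ⟨rfl, rfl⟩ | ⟨rfl, rfl⟩
  · have : Std.Symm (G.restrict {e i}ᶜ).Adj := ⟨fun _ _ h => Graph.Adj.symm h⟩
    exact Relation.ReflTransGen.stdSymm.symm _ _ hp
  · exact hp

end TaitGraph

/-! ### Sides of ends and connectivity of black regions. -/

namespace ConnectedLinkDiagram

variable {C : Type*} {D : ConnectedLinkDiagram C}

theorem region_rot_symm_opp (d : C × ZMod 4) :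
    D.region (CrossingMap.rot.symm (D.opp d)) = D.region d := by
  refine Quotient.sound (s := Equiv.Perm.SameCycle.setoid D.facePerm) ?_
  exact (Equiv.Perm.SameCycle.refl D.facePerm d).apply_left

theorem region_opp (d : C × ZMod 4) :
    D.region (D.opp d) = D.region (CrossingMap.rot.symm d) := by
  rw [← region_rot_symm_opp (D.opp d), D.opp_opp]

theorem exists_region_eq (r : D.Region) : ∃ d, D.region d = r := Quotient.exists_rep r

theorem finite_region (D : ConnectedLinkDiagram C) : Finite D.Region :=
  have := D.finite
  Quotient.finite _

theorem rot_symm_apply (c : C) (i : ZMod 4) :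
    CrossingMap.rot.symm (c, i) = (c, i - 1) := by
  rw [Equiv.symm_apply_eq]
  simp [CrossingMap.rot]

namespace Coloring

theorem black_rot_symm (κ : D.Coloring) (d : C × ZMod 4) :
    κ.black (D.region (CrossingMap.rot.symm d)) ↔ ¬ κ.black (D.region d) := by
  obtain ⟨c, i⟩ := d
  have h := κ.alternates c (i - 1)
  rw [sub_add_cancel] at h
  rw [rot_symm_apply, h, not_not]

theorem swap_black (κ : D.Coloring) (r : D.Region) : κ.swap.black r ↔ ¬ κ.black r := Iff.rfl

open Classical in
/-- The black region on one of the two sides of the end `d`. -/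
noncomputable def blackSide (κ : D.Coloring) (d : C × ZMod 4) : D.Region :=
  if κ.black (D.region d) then D.region d else D.region (CrossingMap.rot.symm d)

theorem blackSide_of_black {κ : D.Coloring} {d : C × ZMod 4} (h : κ.black (D.region d)) :
    κ.blackSide d = D.region d := if_pos h

theorem blackSide_of_not_black {κ : D.Coloring} {d : C × ZMod 4} (h : ¬ κ.black (D.region d)) :
    κ.blackSide d = D.region (CrossingMap.rot.symm d) := if_neg h

theorem blackSide_add_one {κ : D.Coloring} {c : C} {i : ZMod 4} (h : κ.black (D.region (c, i))) :
    κ.blackSide (c, i + 1) = D.region (c, i) := by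
  rw [blackSide_of_not_black (by rwa [κ.alternates, not_not]), rot_symm_apply, add_sub_cancel_right]

/-- The left side of an edge of the projection is its right side when seen from the other end. -/
theorem blackSide_opp (κ : D.Coloring) (d : C × ZMod 4) :
    κ.blackSide (D.opp d) = κ.blackSide d := by
  by_cases h : κ.black (D.region d)
  · rw [blackSide_of_black h, blackSide_of_not_black, region_rot_symm_opp]
    rwa [region_opp, black_rot_symm, not_not]
  · rw [blackSide_of_not_black h, blackSide_of_black, region_opp]
    rwa [region_opp, black_rot_symm]

theorem blackSide_eq_or {κ : D.Coloring} {c : C} {i : ZMod 4} (hi : κ.black (D.region (c, i))) (j : ZMod 4) :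
    κ.blackSide (c, j) = D.region (c, i) ∨ κ.blackSide (c, j) = D.region (c, i + 2) := by
  by_cases hj : κ.black (D.region (c, j))
  · rw [blackSide_of_black hj]
    rcases κ.eq_or_eq_add_two hi hj with rfl | rfl
    · exact Or.inl rfl
    · exact Or.inr rfl
  · rw [blackSide_of_not_black hj]
    rw [← black_rot_symm, rot_symm_apply] at hj
    rw [rot_symm_apply]
    rcases κ.eq_or_eq_add_two hi hj with h | h
    · exact Or.inl (by rw [h])
    · exact Or.inr (by rw [h])

/-- Two black regions are connected in the spanning subgraph of the Tait graph with edge set `H`. -/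
def Conn (κ : D.Coloring) (H : Set C) : D.Region → D.Region → Prop :=
  Relation.ReflTransGen (κ.tait.restrict H).Adj

theorem restrict_tait_adj {κ : D.Coloring} {H : Set C} {r r' : D.Region} :
    (κ.tait.restrict H).Adj r r' ↔
      ∃ c ∈ H, ∃ i, κ.black (D.region (c, i)) ∧ r = D.region (c, i) ∧ r' = D.region (c, i + 2) :=
  Iff.rfl

namespace Conn

variable {κ : D.Coloring} {H : Set C} {r r' r'' : D.Region}

theorem symm (h : κ.Conn H r r') : κ.Conn H r' r := by
  have : Std.Symm (κ.tait.restrict H).Adj := ⟨fun _ _ h => Graph.Adj.symm h⟩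
  exact Relation.ReflTransGen.stdSymm.symm _ _ h

theorem trans (h : κ.Conn H r r') (h' : κ.Conn H r' r'') : κ.Conn H r r'' :=
  Relation.ReflTransGen.trans h h'

theorem refl (κ : D.Coloring) (H : Set C) (r : D.Region) : κ.Conn H r r :=
  Relation.ReflTransGen.refl

theorem of_black {c : C} {i : ZMod 4} (hc : c ∈ H) (h : κ.black (D.region (c, i))) :
    κ.Conn H (D.region (c, i)) (D.region (c, i + 2)) :=
  Relation.ReflTransGen.single (restrict_tait_adj.2 ⟨c, hc, i, h, rfl, rfl⟩)

theorem black_iff (h : κ.Conn H r r') : κ.black r ↔ κ.black r' := by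
  induction h with
  | refl => exact Iff.rfl
  | tail _ hbc ih =>
    obtain ⟨c, _, i, _, rfl, rfl⟩ := restrict_tait_adj.1 hbc
    rw [ih, black_add_two]

end Conn

/-! ### Coboundaries modulo 2 and planarity. -/

open Classical in
/-- One of the two black corners at a crossing. -/
noncomputable def corner (κ : D.Coloring) (c : C) : ZMod 4 :=
  if κ.black (D.region (c, 0)) then 0 else 1

theorem black_corner (κ : D.Coloring) (c : C) : κ.black (D.region (c, κ.corner c)) := by
  unfold corner
  split_ifs with h
  · exact h
  · simpa using (κ.alternates c 0).2 h

/-- The coboundary of a function on the vertices of the Tait graph, modulo 2. -/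
noncomputable def coboundary (κ : D.Coloring) : (D.Region → ZMod 2) →ₗ[ZMod 2] (C → ZMod 2) where
  toFun f c := f (D.region (c, κ.corner c)) + f (D.region (c, κ.corner c + 2))
  map_add' f g := by ext c; simp only [Pi.add_apply]; ring
  map_smul' a f := by ext c; simp only [Pi.smul_apply, smul_eq_mul, RingHom.id_apply]; ring

theorem coboundary_apply {κ : D.Coloring} {c : C} {i : ZMod 4} (h : κ.black (D.region (c, i)))
    (f : D.Region → ZMod 2) :
    κ.coboundary f c = f (D.region (c, i)) + f (D.region (c, i + 2)) := by
  change f (D.region (c, κ.corner c)) + f (D.region (c, κ.corner c + 2)) = _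
  rcases κ.eq_or_eq_add_two h (κ.black_corner c) with h' | h' <;> rw [h']
  rw [add_two_add_two, add_comm]

/-- `z` counts modulo 2 how often a walk uses each edge; the sum of the coboundary along the walk
telescopes. -/
theorem Conn.exists_dotProduct_coboundary [Fintype C] {κ : D.Coloring} {H : Set C}
    {r r' : D.Region} (h : κ.Conn H r r') :
    ∃ z : C → ZMod 2, (∀ c ∉ H, z c = 0) ∧ ∀ f, f r + f r' = z ⬝ᵥ κ.coboundary f := by
  classical
  induction h with
  | refl => exact ⟨0, fun _ _ => rfl, fun f => by simp [CharTwo.add_self_eq_zero]⟩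
  | tail _ hbc ih =>
    obtain ⟨z, hz, hzf⟩ := ih
    obtain ⟨c, hc, i, hi, rfl, rfl⟩ := restrict_tait_adj.1 hbc
    refine ⟨z + Pi.single c 1, fun e he => ?_, fun f => ?_⟩
    · have : e ≠ c := fun h => he (h ▸ hc)
      simp [hz e he, this]
    · rw [add_dotProduct, ← hzf, single_one_dotProduct, coboundary_apply hi]
      linear_combination (-1 : ZMod 2) * CharTwo.add_self_eq_zero (f (D.region (c, i)))

/-- Expanding the product gives four terms, one for each pair of adjacent corners, that is, for each
end separating a black corner from a white one. -/
theorem coboundary_mul_coboundary_swap (κ : D.Coloring) (a b : D.Region → ZMod 2) (c : C) :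
    κ.coboundary a c * κ.swap.coboundary b c =
      ∑ i : ZMod 4, a (κ.blackSide (c, i)) * b (κ.swap.blackSide (c, i)) := by
  have key : ∀ (κ : D.Coloring) (a b : D.Region → ZMod 2) (i : ZMod 4),
      κ.black (D.region (c, i)) → κ.coboundary a c * κ.swap.coboundary b c =
        ∑ i : ZMod 4, a (κ.blackSide (c, i)) * b (κ.swap.blackSide (c, i)) := by
    intro κ a b i hi
    have hi1 : κ.swap.black (D.region (c, i + 1)) := by
      rwa [swap_black, κ.alternates, not_not]
    have hi2 : κ.black (D.region (c, i + 2)) := (κ.black_add_two c i).2 hi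
    have hi3 : κ.swap.black (D.region (c, i + 1 + 2)) := (κ.swap.black_add_two c _).2 hi1
    have e0 : i + 1 + 2 + 1 = i := (by decide : ∀ i : ZMod 4, i + 1 + 2 + 1 = i) i
    have e2 : i + 1 + 1 = i + 2 := by ring
    have e3 : i + 2 + 1 = i + 1 + 2 := by ring
    have b0 := blackSide_of_black hi
    have b1 := blackSide_add_one hi
    have b2 := blackSide_of_black hi2
    have b3 := blackSide_add_one hi2
    have w0 := blackSide_add_one hi3
    have w1 := blackSide_of_black hi1
    have w2 := blackSide_add_one hi1
    have w3 := blackSide_of_black hi3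
    rw [e0] at w0
    rw [e2] at w2
    rw [e3] at b3
    have hsum : ∀ g : ZMod 4 → ZMod 2, ∑ j, g j = g i + g (i + 1) + g (i + 2) + g (i + 1 + 2) := by
      intro g
      rw [← Equiv.sum_comp (Equiv.addLeft i) g]
      refine (Fin.sum_univ_four _).trans ?_
      have e4 : i + 1 + 2 = i + 3 := by ring
      rw [e4]
      change g (i + 0) + g (i + 1) + g (i + 2) + g (i + 3) = _
      rw [add_zero]
    rw [hsum, b0, b1, b2, b3, w0, w1, w2, w3, coboundary_apply hi, coboundary_apply hi1]
    ring
  exact key κ a b _ (κ.black_corner c)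

/-- Summed over all ends, the terms cancel in pairs: the two ends of an edge of the projection have
the same black side and the same white side. -/
theorem coboundary_dotProduct_coboundary_swap [Fintype C] (κ : D.Coloring)
    (a b : D.Region → ZMod 2) : κ.coboundary a ⬝ᵥ κ.swap.coboundary b = 0 := by
  simp only [dotProduct, coboundary_mul_coboundary_swap]
  rw [← Fintype.sum_prod_type'
    (f := fun c i => a (κ.blackSide (c, i)) * b (κ.swap.blackSide (c, i)))]
  refine Finset.sum_involution (fun d _ => D.opp d) ?_ (fun d _ _ => D.opp_ne d)
    (fun _ _ => Finset.mem_univ _) (fun d _ => D.opp_opp d)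
  intro d _
  simp only [Prod.mk.eta, blackSide_opp, CharTwo.add_self_eq_zero]

theorem eq_of_joined {κ : D.Coloring} {f : D.Region → ZMod 2} {c c' : C}
    (h : D.Joined c c') (hf : κ.coboundary f = 0) {d : C × ZMod 4} {d' : C × ZMod 4}
    (hd : d.1 = c) (hd' : d'.1 = c') (hb : κ.black (D.region d)) (hb' : κ.black (D.region d')) :
    f (D.region d) = f (D.region d') := by
  have key : ∀ (d : C × ZMod 4) (e : C × ZMod 4), d.1 = e.1 → κ.black (D.region d) →
      f (D.region d) = f (κ.blackSide e) := by
    rintro ⟨c, i⟩ ⟨c', j⟩ hc hi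
    obtain rfl : c = c' := hc
    have h0 := congrFun hf c
    rw [coboundary_apply hi, Pi.zero_apply, CharTwo.add_eq_zero] at h0
    rcases blackSide_eq_or hi j with h | h
    · rw [h]
    · rw [h, h0]
  obtain ⟨i, j, hij⟩ := h
  rw [key d (c, i) hd hb, key d' (c', j) hd' hb', ← hij, blackSide_opp]

/-- The Tait graph is connected because the projection is: joined crossings share a black region
along the edge between them. -/
theorem eq_of_coboundary_eq_zero {κ : D.Coloring} {f : D.Region → ZMod 2}
    (hf : κ.coboundary f = 0) {r r' : D.Region} (hr : κ.black r) (hr' : κ.black r') :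
    f r = f r' := by
  have hcorner : ∀ c c', f (D.region (c, κ.corner c)) = f (D.region (c', κ.corner c')) := by
    intro c c'
    induction D.connected c c' with
    | refl => rfl
    | tail _ hbc ih =>
      exact ih.trans (eq_of_joined hbc hf rfl rfl (κ.black_corner _) (κ.black_corner _))
  have key : ∀ r, κ.black r → ∃ c, f r = f (D.region (c, κ.corner c)) := by
    intro r hr
    obtain ⟨⟨c, i⟩, rfl⟩ := exists_region_eq r
    have h0 := congrFun hf c
    rw [coboundary_apply hr, Pi.zero_apply, CharTwo.add_eq_zero] at h0
    refine ⟨c, ?_⟩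
    rcases κ.eq_or_eq_add_two hr (κ.black_corner c) with h | h <;> rw [h]
    exact h0
  obtain ⟨c, hc⟩ := key r hr
  obtain ⟨c', hc'⟩ := key r' hr'
  rw [hc, hc', hcorner]

/-- Euler's formula: the coboundary spaces of the Tait graph and of its dual have complementary
dimensions. -/
theorem card_le_finrank_range_coboundary [Fintype C] [Nonempty C] (κ : D.Coloring) :
    Fintype.card C ≤ Module.finrank (ZMod 2) (LinearMap.range κ.coboundary) +
      Module.finrank (ZMod 2) (LinearMap.range κ.swap.coboundary) := by
  have := finite_region D
  have := Fintype.ofFinite D.Region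
  obtain ⟨c⟩ := ‹Nonempty C›
  let Ψ := κ.coboundary.rangeRestrict.prod κ.swap.coboundary.rangeRestrict
  let Φ : (D.Region → ZMod 2) →ₗ[ZMod 2] (ZMod 2 × ZMod 2) :=
    (LinearMap.proj (D.region (c, κ.corner c))).prod
      (LinearMap.proj (D.region (c, κ.swap.corner c)))
  -- The kernel of `Ψ` has dimension at most 2: its elements are constant on black and on white
  -- regions. With `|C| + 2` regions, the rank of `Ψ` is at least `|C|`.
  have hinj : Function.Injective (Φ.domRestrict (LinearMap.ker Ψ)) := by
    rw [← LinearMap.ker_eq_bot, LinearMap.ker_eq_bot']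
    rintro ⟨f, hf⟩ h
    have hf' : Ψ f = 0 := hf
    have h1 : κ.coboundary f = 0 := congrArg (fun p => (p.1 : C → ZMod 2)) hf'
    have h2 : κ.swap.coboundary f = 0 := congrArg (fun p => (p.2 : C → ZMod 2)) hf'
    have h3 : f (D.region (c, κ.corner c)) = 0 := congrArg Prod.fst h
    have h4 : f (D.region (c, κ.swap.corner c)) = 0 := congrArg Prod.snd h
    ext r
    change f r = 0
    by_cases hr : κ.black r
    · rw [eq_of_coboundary_eq_zero h1 hr (κ.black_corner c), h3]
    · rw [eq_of_coboundary_eq_zero h2 (κ := κ.swap) hr (κ.swap.black_corner c), h4]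
  have hker := LinearMap.finrank_le_finrank_of_injective hinj
  have hrange := Submodule.finrank_le (LinearMap.range Ψ)
  have hrank := LinearMap.finrank_range_add_finrank_ker Ψ
  rw [Module.finrank_prod] at hker hrange
  rw [Module.finrank_pi, ← Nat.card_eq_fintype_card, D.planar, Nat.card_eq_fintype_card] at hrank
  rw [Module.finrank_self] at hker
  omega

/-- The dimension bound turns the inclusion of `A` in the annihilator of `B` into equality, so `y`
lies in `A`. -/
theorem _root_.dotProduct_eq_zero_of_orthogonal {K ι : Type*} [Field K] [Fintype ι]
    {A B : Submodule K (ι → K)} (hAB : ∀ a ∈ A, ∀ b ∈ B, a ⬝ᵥ b = 0)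
    (hcard : Fintype.card ι ≤ Module.finrank K A + Module.finrank K B)
    {x y : ι → K} (hx : ∀ a ∈ A, x ⬝ᵥ a = 0) (hy : ∀ b ∈ B, y ⬝ᵥ b = 0) : x ⬝ᵥ y = 0 := by
  let β : LinearMap.BilinForm K (ι → K) := dotProductBilin K K
  have hker : β.ker = ⊥ := by
    rw [LinearMap.ker_eq_bot']
    intro v hv
    exact dotProduct_eq_zero v fun w => LinearMap.congr_fun hv w
  have hle : A ≤ β.orthogonal B := fun a ha b hb => by
    change b ⬝ᵥ a = 0
    rw [dotProduct_comm, hAB a ha b hb]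
  have hfin := LinearMap.BilinForm.finrank_add_finrank_orthogonal' (B := β) B
  rw [hker, inf_bot_eq, finrank_bot, add_zero, Module.finrank_pi] at hfin
  have heq := Submodule.eq_of_le_of_finrank_le hle (by omega)
  refine hx y ?_
  rw [heq]
  intro b hb
  change b ⬝ᵥ y = 0
  rw [dotProduct_comm, hy b hb]

/-- Planarity: a closed curve through black regions and a closed curve through white regions do not
meet in exactly one crossing. -/
theorem not_conn_of_conn_swap {κ : D.Coloring} {H H' : Set C} (hH : Disjoint H H')
    {c : C} (hc : c ∉ H) (hc' : c ∉ H') {i : ZMod 4} {j : ZMod 4}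
    (hi : κ.black (D.region (c, i))) (hj : κ.swap.black (D.region (c, j)))
    (h : κ.Conn H (D.region (c, i)) (D.region (c, i + 2))) :
    ¬ κ.swap.Conn H' (D.region (c, j)) (D.region (c, j + 2)) := by
  classical
  intro h'
  have := D.finite
  have := Fintype.ofFinite C
  have : Nonempty C := ⟨c⟩
  obtain ⟨z, hz, hzf⟩ := h.exists_dotProduct_coboundary
  obtain ⟨z', hz', hzf'⟩ := h'.exists_dotProduct_coboundary
  -- Closing each walk with the edge `c` gives a cycle of G and a cycle of the dual. Their supports
  -- share only `c`, so their product is 1, while orthogonality makes it 0.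
  have hx : ∀ a ∈ LinearMap.range κ.coboundary, (z + Pi.single c 1) ⬝ᵥ a = 0 := by
    rintro _ ⟨f, rfl⟩
    rw [add_dotProduct, ← hzf, single_one_dotProduct, coboundary_apply hi,
      CharTwo.add_self_eq_zero]
  have hy : ∀ a ∈ LinearMap.range κ.swap.coboundary, (z' + Pi.single c 1) ⬝ᵥ a = 0 := by
    rintro _ ⟨f, rfl⟩
    rw [add_dotProduct, ← hzf', single_one_dotProduct, coboundary_apply hj,
      CharTwo.add_self_eq_zero]
  have h0 := dotProduct_eq_zero_of_orthogonal (by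
    rintro _ ⟨a, rfl⟩ _ ⟨b, rfl⟩
    exact κ.coboundary_dotProduct_coboundary_swap a b) κ.card_le_finrank_range_coboundary hx hy
  have hzz : z ⬝ᵥ z' = 0 := by
    refine Finset.sum_eq_zero fun e _ => ?_
    by_cases he : e ∈ H
    · rw [hz' e (Set.disjoint_left.1 hH he), mul_zero]
    · rw [hz e he, zero_mul]
  rw [add_dotProduct, dotProduct_add, hzz, dotProduct_single_one, single_one_dotProduct, hz c hc,
    Pi.add_apply, hz' c hc', Pi.single_eq_same] at h0
  simp at h0

end Coloring

end ConnectedLinkDiagram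

/-! ### State circles and adequacy. -/

namespace ConnectedLinkDiagram

variable {C : Type*} {D : ConnectedLinkDiagram C}

theorem partner_partner (r : Resolution) (i : ZMod 4) : partner r (partner r i) = i := by
  cases r <;> simp [partner]

theorem partner_ne (r : Resolution) (i : ZMod 4) : partner r i ≠ i := by
  cases r <;> revert i <;> decide

theorem circle_opp (σ : D.State) (d : C × ZMod 4) : D.circle σ (D.opp d) = D.circle σ d :=
  (Quot.sound (r := D.CircleStep σ) (Or.inl rfl)).symm

theorem circle_partner (σ : D.State) (c : C) (i : ZMod 4) :
    D.circle σ (c, partner (σ c) i) = D.circle σ (c, i) :=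
  (Quot.sound (r := D.CircleStep σ) (a := (c, i)) (Or.inr rfl)).symm

/-- If the two ends bounding the corner `channel (σ c)` lie on the same state circle, then so do all
four ends at `c`. -/
theorem circle_eq_of_channel {σ : D.State} {c : C}
    (h : D.circle σ (c, channel (σ c)) = D.circle σ (c, channel (σ c) + 1)) :
    D.circle σ (c, 0) = D.circle σ (c, 2) := by
  have h0 := circle_partner σ c 0
  have h1 := circle_partner σ c 1
  have h2 := circle_partner σ c 2
  generalize D.circle σ = γ at *
  generalize σ c = r at *
  cases r
  · exact h0.symm.trans h
  · exact h.trans h1.symm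

namespace Coloring

variable {κ : D.Coloring} {σ : D.State} {c : C}

theorem mem_edgesOf : c ∈ κ.edgesOf σ ↔ κ.black (D.region (c, channel (σ c))) := by
  have h : κ.black (D.region (c, channel .A)) ↔ ¬ κ.black (D.region (c, channel .B)) :=
    κ.alternates c 0
  by_cases hb : κ.black (D.region (c, channel .A)) <;> cases hr : σ c <;>
    simp_all [edgesOf, sign]

theorem edgesOf_swap : κ.swap.edgesOf σ = (κ.edgesOf σ)ᶜ := by
  ext c
  rw [Set.mem_compl_iff, mem_edgesOf, mem_edgesOf, swap_black]

theorem conn_blackSide_of_mem {H : Set C} (hc : c ∈ H) (i j : ZMod 4) :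
    κ.Conn H (κ.blackSide (c, i)) (κ.blackSide (c, j)) := by
  have h := Conn.of_black hc (κ.black_corner c)
  rcases blackSide_eq_or (κ.black_corner c) i with hi | hi <;>
    rcases blackSide_eq_or (κ.black_corner c) j with hj | hj <;> rw [hi, hj]
  · exact .refl ..
  · exact h
  · exact h.symm
  · exact .refl ..

/-- The channel is white here, so the two connected ends bound a common black corner. -/
theorem blackSide_partner (hc : c ∉ κ.edgesOf σ) (i : ZMod 4) :
    κ.blackSide (c, partner (σ c) i) = κ.blackSide (c, i) := by
  rw [mem_edgesOf] at hc
  generalize σ c = r at hc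
  have h1 : κ.black (D.region (c, channel r + 1)) := (κ.alternates c _).2 hc
  have h3 := (κ.black_add_two c _).2 h1
  have key : (partner r i = i + 1 ∧ (i = channel r + 1 ∨ i = channel r + 1 + 2)) ∨
      (i = partner r i + 1 ∧
        (partner r i = channel r + 1 ∨ partner r i = channel r + 1 + 2)) := by
    clear * -
    cases r <;> revert i <;> decide
  rcases key with ⟨h, h'⟩ | ⟨h, h'⟩
  · have hb : κ.black (D.region (c, i)) := by rcases h' with h' | h' <;> rwa [h']
    rw [h, blackSide_add_one hb, blackSide_of_black hb]
  · have hb : κ.black (D.region (c, partner r i)) := by rcases h' with h' | h' <;> rwa [h']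
    rw [blackSide_of_black hb, ← blackSide_add_one hb, ← h]

theorem conn_blackSide_of_circle_eq {d d' : C × ZMod 4} (h : D.circle σ d = D.circle σ d') :
    κ.Conn (κ.edgesOf σ) (κ.blackSide d) (κ.blackSide d') := by
  have hstep : ∀ x y, D.CircleStep σ x y →
      κ.Conn (κ.edgesOf σ) (κ.blackSide x) (κ.blackSide y) := by
    rintro ⟨c, i⟩ y (rfl | rfl)
    · rw [blackSide_opp]
      exact .refl ..
    · by_cases hc : c ∈ κ.edgesOf σ
      · exact conn_blackSide_of_mem hc _ _
      · rw [blackSide_partner hc]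
        exact .refl ..
  have := congrArg (Quot.lift (fun x => κ.Conn (κ.edgesOf σ) (κ.blackSide d) (κ.blackSide x))
    fun x y hxy => propext ⟨fun h => h.trans (hstep x y hxy),
      fun h => h.trans (hstep x y hxy).symm⟩) h
  exact this.mp (.refl ..)

/-- If the segment at a crossing in `E_σ` joins different state circles, then the corresponding edge
is not a bridge of `G|E_σ`. -/
theorem conn_of_circle_ne (hc : c ∈ κ.edgesOf σ) (h : D.circle σ (c, 0) ≠ D.circle σ (c, 2)) :
    κ.Conn (κ.edgesOf σ \ {c}) (D.region (c, channel (σ c)))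
      (D.region (c, channel (σ c) + 2)) := by
  classical
  have := D.finite
  have := Fintype.ofFinite C
  by_contra hconn
  refine h (circle_eq_of_channel ?_)
  by_contra hne
  set k := channel (σ c)
  have hk : κ.black (D.region (c, k)) := mem_edgesOf.1 hc
  -- `W` collects the ends met on leaving `c` along `k` and following the state circle without
  -- passing through the resolution at `c`.
  let R : C × ZMod 4 → C × ZMod 4 → Prop := fun d d' =>
    d' = D.opp d ∨ (d.1 ≠ c ∧ d' = (d.1, partner (σ d.1) d.2))
  let W : Finset (C × ZMod 4) := Finset.univ.filter (Relation.ReflTransGen R (c, k))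
  have hW : ∀ d, d ∈ W ↔ Relation.ReflTransGen R (c, k) d := fun d => by simp [W]
  have hcircle : ∀ d ∈ W, D.circle σ d = D.circle σ (c, k) := by
    intro d hd
    rw [hW] at hd
    induction hd with
    | refl => rfl
    | tail _ hbc ih =>
      rcases hbc with rfl | ⟨_, rfl⟩
      · rw [circle_opp, ih]
      · rw [circle_partner, ih]
  have hside : ∀ d ∈ W, κ.Conn (κ.edgesOf σ \ {c}) (D.region (c, k)) (κ.blackSide d) := by
    intro d hd
    rw [hW] at hd
    induction hd with
    | refl => rw [blackSide_of_black hk]; exact .refl ..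
    | @tail b _ _ hbc ih =>
      rcases hbc with rfl | ⟨hb, rfl⟩
      · rwa [blackSide_opp]
      · obtain ⟨b, i⟩ := b
        by_cases hbE : b ∈ κ.edgesOf σ
        · exact ih.trans (conn_blackSide_of_mem (Set.mem_sdiff_of_mem hbE hb) _ _)
        · rwa [blackSide_partner hbE]
  -- End `k + 1` lies on another circle by `hne`; ends `k + 2` and `k + 3` have a black side not
  -- connected to the starting one by `hconn`.
  have hWc : ∀ i, (c, i) ∈ W → i = k := by
    intro i hi
    have hs := hside _ hi
    have hcases : ∀ i k : ZMod 4, i = k ∨ i = k + 1 ∨ i = k + 2 ∨ i = k + 2 + 1 := by decide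
    have hk2 := (κ.black_add_two c k).2 hk
    rcases hcases i k with rfl | rfl | rfl | rfl
    · rfl
    · exact absurd (hcircle _ hi).symm hne
    · rw [blackSide_of_black hk2] at hs
      exact absurd hs hconn
    · rw [blackSide_add_one hk2] at hs
      exact absurd hs hconn
  have hk0 : (c, k) ∈ W := (hW _).2 .refl
  -- `opp` pairs off all of `W`, while the resolutions pair off `W` without `(c, k)`; hence both
  -- cardinalities would be even.
  have heven : ∑ d ∈ W, (1 : ZMod 2) = 0 :=
    Finset.sum_involution (fun d _ => D.opp d) (fun _ _ => by decide) (fun d _ _ => D.opp_ne d)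
      (fun d hd => (hW _).2 (((hW d).1 hd).tail (Or.inl rfl))) (fun d _ => D.opp_opp d)
  have hodd : ∑ d ∈ W.erase (c, k), (1 : ZMod 2) = 0 := by
    have hdc : ∀ d ∈ W.erase (c, k), d.1 ≠ c := by
      rintro ⟨b, i⟩ hd rfl
      rw [Finset.mem_erase] at hd
      exact hd.1 (by rw [hWc i hd.2])
    refine Finset.sum_involution (fun d _ => (d.1, partner (σ d.1) d.2)) (fun _ _ => by decide)
      (fun d _ _ hd => partner_ne _ _ (congrArg Prod.snd hd)) (fun d hd => ?_)
      (fun d _ => by simp [partner_partner])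
    rw [Finset.mem_erase]
    refine ⟨fun h => hdc d hd (congrArg Prod.fst h), ?_⟩
    exact (hW _).2 (((hW d).1 (Finset.mem_of_mem_erase hd)).tail (Or.inr ⟨hdc d hd, rfl⟩))
  rw [← Finset.add_sum_erase _ _ hk0, hodd] at heven
  exact absurd heven (by decide)

/-- At a crossing in `E_σ` the state segment joins different state circles if and only if the
corresponding edge is not a bridge of `G|E_σ`. -/
theorem circle_ne_iff_of_mem (hc : c ∈ κ.edgesOf σ) :
    D.circle σ (c, 0) ≠ D.circle σ (c, 2) ↔
      κ.Conn (κ.edgesOf σ \ {c}) (D.region (c, channel (σ c)))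
        (D.region (c, channel (σ c) + 2)) := by
  refine ⟨conn_of_circle_ne hc, fun h heq => ?_⟩
  have hw : κ.swap.black (D.region (c, κ.swap.corner c)) := κ.swap.black_corner c
  -- If the two arcs at `c` lie on one circle, its white side connects the two white corners off
  -- `E_σ`, against planarity.
  have hcirc : D.circle σ (c, κ.swap.corner c) = D.circle σ (c, κ.swap.corner c + 2) := by
    unfold corner
    split_ifs
    · simpa using heq
    · have h0 := circle_partner σ c 0
      have h2 := circle_partner σ c 2
      have h1 := circle_partner σ c 1
      have h3 := circle_partner σ c 3
      generalize D.circle σ = γ at *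
      generalize σ c = r at *
      cases r
      · exact h0.trans (heq.trans h2.symm)
      · exact h1.symm.trans (heq.symm.trans h3)
  have := conn_blackSide_of_circle_eq (κ := κ.swap) hcirc
  rw [blackSide_of_black hw, blackSide_of_black ((κ.swap.black_add_two c _).2 hw),
    edgesOf_swap] at this
  exact not_conn_of_conn_swap (Disjoint.mono_left Set.sdiff_subset disjoint_compl_right)
    (by simp) (by simpa using hc) (mem_edgesOf.1 hc) hw h this

theorem circle_ne_iff_of_notMem (hc : c ∉ κ.edgesOf σ) :
    D.circle σ (c, 0) ≠ D.circle σ (c, 2) ↔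
      ¬ κ.Conn (κ.edgesOf σ) (D.region (c, channel (σ c) + 1))
        (D.region (c, channel (σ c) + 1 + 2)) := by
  have hb : κ.black (D.region (c, channel (σ c) + 1)) := by
    rwa [κ.alternates, ← mem_edgesOf]
  constructor
  · intro h hconn
    have hc' : c ∈ κ.swap.edgesOf σ := by rwa [edgesOf_swap]
    have := conn_of_circle_ne hc' h
    rw [edgesOf_swap] at this
    exact not_conn_of_conn_swap (Disjoint.mono_right Set.sdiff_subset disjoint_compl_right)
      hc (by simp) hb (mem_edgesOf.1 hc') hconn this
  · intro h heq
    refine h ?_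
    have := conn_blackSide_of_circle_eq (κ := κ) heq
    -- The black sides of the opposite ends 0 and 2 are the two black corners, in one order or the
    -- other.
    have h02 : ∀ i : ZMod 4, κ.black (D.region (c, i)) →
        κ.Conn (κ.edgesOf σ) (κ.blackSide (c, 0)) (κ.blackSide (c, 2)) →
        κ.Conn (κ.edgesOf σ) (D.region (c, i)) (D.region (c, i + 2)) := by
      intro i hi h
      have key : ∀ i : ZMod 4, (i = 0 ∧ i + 2 = 2) ∨ (i + 2 = 0 ∧ i = 2) ∨
          (i + 2 + 1 = 0 ∧ i + 1 = 2) ∨ (i + 1 = 0 ∧ i + 2 + 1 = 2) := by decide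
      have hi2 := (κ.black_add_two c i).2 hi
      rw [← blackSide_of_black hi, ← blackSide_of_black hi2]
      rcases key i with ⟨h1, h2⟩ | ⟨h1, h2⟩ | ⟨h1, h2⟩ | ⟨h1, h2⟩
      · rwa [h2, h1]
      · rw [h1, h2]; exact h.symm
      · rw [blackSide_of_black hi, blackSide_of_black hi2, ← blackSide_add_one hi,
          ← blackSide_add_one hi2, h1, h2]
        exact h.symm
      · rwa [blackSide_of_black hi, blackSide_of_black hi2, ← blackSide_add_one hi,
          ← blackSide_add_one hi2, h1, h2]
    exact h02 _ hb this

theorem inCycle_tait_iff {H : Set C} (hc : c ∈ H) {i : ZMod 4}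
    (hi : κ.black (D.region (c, i))) :
    TaitGraph.InCycle (κ.tait.restrict H) c ↔
      κ.Conn (H \ {c}) (D.region (c, i)) (D.region (c, i + 2)) := by
  rw [TaitGraph.inCycle_iff (G := κ.tait.restrict H) (x := D.region (c, i)) (y := D.region (c, i + 2))
    ⟨hc, i, hi, rfl, rfl⟩, Graph.restrict_restrict]
  rfl

theorem not_inc_subset_component_iff {H : Set C} {i : ZMod 4}
    (hi : κ.black (D.region (c, i))) :
    (∀ S, TaitGraph.IsComponent (κ.tait.restrict H) S → ¬ ∀ r, κ.tait.Inc c r → r ∈ S) ↔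
      ¬ κ.Conn H (D.region (c, i)) (D.region (c, i + 2)) := by
  constructor
  · intro h hconn
    refine h _ ⟨D.region (c, i), hi, rfl⟩ ?_
    rintro _ ⟨_, j, hj, rfl, _⟩
    rcases κ.eq_or_eq_add_two hi hj with rfl | rfl
    · exact Conn.refl ..
    · exact hconn
  · rintro h _ ⟨x, _, rfl⟩ hS
    have h1 : κ.Conn H x (D.region (c, i)) := hS _ ⟨_, i, hi, rfl, rfl⟩
    have h2 : κ.Conn H x (D.region (c, i + 2)) :=
      hS _ ⟨_, i + 2, (κ.black_add_two c i).2 hi, rfl, rfl⟩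
    exact h (h1.symm.trans h2)

theorem isAdequate_iff (κ : D.Coloring) (σ : D.State) : D.IsAdequate σ ↔
    (∀ c ∈ κ.edgesOf σ, TaitGraph.InCycle (κ.tait.restrict (κ.edgesOf σ)) c) ∧
    ∀ c ∉ κ.edgesOf σ, ∀ S, TaitGraph.IsComponent (κ.tait.restrict (κ.edgesOf σ)) S →
      ¬ ∀ r, κ.tait.Inc c r → r ∈ S := by
  have hin : ∀ c ∈ κ.edgesOf σ, (D.circle σ (c, 0) ≠ D.circle σ (c, 2) ↔
      TaitGraph.InCycle (κ.tait.restrict (κ.edgesOf σ)) c) := fun c hc => by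
    rw [circle_ne_iff_of_mem hc, inCycle_tait_iff hc (mem_edgesOf.1 hc)]
  have hout : ∀ c ∉ κ.edgesOf σ, (D.circle σ (c, 0) ≠ D.circle σ (c, 2) ↔
      ∀ S, TaitGraph.IsComponent (κ.tait.restrict (κ.edgesOf σ)) S →
        ¬ ∀ r, κ.tait.Inc c r → r ∈ S) := fun c hc => by
    rw [circle_ne_iff_of_notMem hc,
      not_inc_subset_component_iff (by rwa [κ.alternates, ← mem_edgesOf])]
  constructor
  · exact fun h => ⟨fun c hc => (hin c hc).1 (h c), fun c hc => (hout c hc).1 (h c)⟩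
  · rintro ⟨h1, h2⟩ c
    by_cases hc : c ∈ κ.edgesOf σ
    · exact (hin c hc).2 (h1 c hc)
    · exact (hout c hc).2 (h2 c hc)

end Coloring

end ConnectedLinkDiagram

/-! ### Complementary regions and homogeneity. -/

namespace ConnectedLinkDiagram

namespace Coloring

variable {C : Type*} {D : ConnectedLinkDiagram C} {κ : D.Coloring} {σ : D.State}

theorem complementaryRegion_eq_of_conn {r r' : D.Region} (h : κ.Conn (κ.edgesOf σ) r r') :
    (Quot.mk (D.Merged σ) r) = Quot.mk (D.Merged σ) r' := by
  induction h with
  | refl => rfl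
  | tail _ hbc ih =>
    obtain ⟨c, hc, i, hi, rfl, rfl⟩ := restrict_tait_adj.1 hbc
    have hm : Quot.mk (D.Merged σ) (D.region (c, channel (σ c))) =
        Quot.mk (D.Merged σ) (D.region (c, channel (σ c) + 2)) := Quot.sound ⟨c, rfl, rfl⟩
    rw [ih]
    rcases κ.eq_or_eq_add_two (mem_edgesOf.1 hc) hi with rfl | rfl
    · exact hm
    · rw [add_two_add_two]
      exact hm.symm

/-- A merge off `E_σ` involves only white regions, which are never connected to the black region
`r`; hence connectivity to `r` is invariant under every merge. -/
theorem conn_of_complementaryRegion_eq {r r' : D.Region} (hr : κ.black r)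
    (h : Quot.mk (D.Merged σ) r = Quot.mk (D.Merged σ) r') : κ.Conn (κ.edgesOf σ) r r' := by
  have hstep : ∀ x y, D.Merged σ x y →
      κ.Conn (κ.edgesOf σ) r x = κ.Conn (κ.edgesOf σ) r y := by
    rintro _ _ ⟨c, rfl, rfl⟩
    by_cases hc : c ∈ κ.edgesOf σ
    · have hs := Conn.of_black hc (mem_edgesOf.1 hc)
      exact propext ⟨fun h => h.trans hs, fun h => h.trans hs.symm⟩
    · rw [mem_edgesOf] at hc
      exact propext ⟨fun h => absurd (h.black_iff.1 hr) hc,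
        fun h => absurd ((κ.black_add_two c _).1 (h.black_iff.1 hr)) hc⟩
  exact (congrArg (Quot.lift (fun x => κ.Conn (κ.edgesOf σ) r x) hstep) h).mp (.refl ..)

theorem sign_eq_plus_iff {c : C} (hc : c ∈ κ.edgesOf σ) : κ.sign c = .plus ↔ σ c = .A := by
  rcases hc with ⟨h1, h2⟩ | ⟨h1, h2⟩ <;> simp [h1, h2]

theorem sign_swap_eq_plus_iff (c : C) : κ.swap.sign c = .plus ↔ κ.sign c = .minus := by
  by_cases h : κ.black (D.region (c, channel .A)) <;> simp [sign, swap_black, h]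

theorem sign_eq_minus_iff (c : C) : κ.sign c = .minus ↔ κ.sign c ≠ .plus := by
  cases κ.sign c <;> simp

theorem singleSigned_iff {S : Set C} :
    κ.SingleSigned S ↔ ∀ c ∈ S, ∀ c' ∈ S, κ.sign c = .plus → κ.sign c' = .plus := by
  constructor
  · rintro (h | h) c hc c' hc' hp
    · exact h c' hc'
    · rw [h c hc] at hp
      cases hp
  · intro h
    by_cases hex : ∃ c ∈ S, κ.sign c = .plus
    · obtain ⟨c, hc, hp⟩ := hex
      exact Or.inl fun c' hc' => h c hc c' hc' hp
    · push Not at hex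
      exact Or.inr fun c hc => (sign_eq_minus_iff c).2 (hex c hc)

theorem singleSigned_swap {S : Set C} : κ.swap.SingleSigned S ↔ κ.SingleSigned S := by
  simp only [SingleSigned, sign_eq_minus_iff (κ := κ.swap), ne_eq, sign_swap_eq_plus_iff]
  simp only [sign_eq_minus_iff, ne_eq, not_not]
  exact or_comm

theorem segmentRegion_eq_iff {c : C} (hc : c ∈ κ.edgesOf σ) {r : D.Region} :
    D.segmentRegion σ c = Quot.mk _ r ↔
      κ.Conn (κ.edgesOf σ) (D.region (c, channel (σ c))) r :=
  ⟨conn_of_complementaryRegion_eq (mem_edgesOf.1 hc), complementaryRegion_eq_of_conn⟩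

/-- The components of `G|E_σ` are single-signed if and only if no complementary region of the state
circles that consists of black regions contains segments of both kinds. -/
theorem components_singleSigned_iff :
    (∀ S, TaitGraph.IsComponent (κ.tait.restrict (κ.edgesOf σ)) S →
      κ.SingleSigned {c | ∃ r ∈ S, (κ.tait.restrict (κ.edgesOf σ)).Inc c r}) ↔
    ∀ c ∈ κ.edgesOf σ, ∀ c' ∈ κ.edgesOf σ, D.segmentRegion σ c = D.segmentRegion σ c' →
      σ c = .A → σ c' = .A := by
  have hinc : ∀ {c : C} (hc : c ∈ κ.edgesOf σ),
      (κ.tait.restrict (κ.edgesOf σ)).Inc c (D.region (c, channel (σ c))) := fun hc =>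
    ⟨_, hc, _, mem_edgesOf.1 hc, rfl, rfl⟩
  constructor
  · intro h c hc c' hc' heq hA
    rw [← sign_eq_plus_iff hc] at hA
    rw [← sign_eq_plus_iff hc']
    have hconn := (segmentRegion_eq_iff hc).1 heq
    exact singleSigned_iff.1 (h _ ⟨_, mem_edgesOf.1 hc, rfl⟩) c ⟨_, .refl, hinc hc⟩ c'
      ⟨_, hconn, hinc hc'⟩ hA
  · rintro h _ ⟨x, _, rfl⟩
    have key : ∀ c, (∃ r ∈ {y | Relation.ReflTransGen (κ.tait.restrict (κ.edgesOf σ)).Adj x y},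
        (κ.tait.restrict (κ.edgesOf σ)).Inc c r) →
        c ∈ κ.edgesOf σ ∧ D.segmentRegion σ c = Quot.mk _ x := by
      rintro c ⟨r, hr, _, hc, i, hi, rfl, _⟩
      refine ⟨hc, (segmentRegion_eq_iff hc).2 ?_⟩
      have hxr : κ.Conn (κ.edgesOf σ) x (D.region (c, i)) := hr
      refine Conn.trans ?_ hxr.symm
      rcases κ.eq_or_eq_add_two (mem_edgesOf.1 hc) hi with rfl | rfl
      · exact .refl ..
      · exact .of_black hc (mem_edgesOf.1 hc)
    rw [singleSigned_iff]
    intro c hc c' hc' hp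
    obtain ⟨hc, hcx⟩ := key c hc
    obtain ⟨hc', hcx'⟩ := key c' hc'
    rw [sign_eq_plus_iff hc] at hp
    rw [sign_eq_plus_iff hc']
    exact h c hc c' hc' (hcx.trans hcx'.symm) hp

/-- The faces of `G|E_σ` are single-signed if and only if no complementary region of the state
circles that consists of white regions contains segments of both kinds. -/
theorem faces_singleSigned_iff :
    (∀ F, κ.IsFace (κ.edgesOf σ) F → κ.SingleSigned (κ.edgesInside (κ.edgesOf σ) F)) ↔
    ∀ c ∉ κ.edgesOf σ, ∀ c' ∉ κ.edgesOf σ, D.segmentRegion σ c = D.segmentRegion σ c' →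
      σ c = .A → σ c' = .A := by
  have h := components_singleSigned_iff (κ := κ.swap) (σ := σ)
  have hset : ∀ F : Set D.Region,
      {c | ∃ r ∈ F, (κ.swap.tait.restrict (κ.edgesOf σ)ᶜ).Inc c r} =
        κ.edgesInside (κ.edgesOf σ) F := by
    intro F
    ext c
    simp only [Graph.restrict_inc, Set.mem_ofPred_eq, edgesInside, Set.mem_compl_iff, dual]
    tauto
  simp only [edgesOf_swap, singleSigned_swap, hset] at h
  exact h

theorem isHomogeneous_iff (κ : D.Coloring) (σ : D.State) : D.IsHomogeneous σ ↔
    (∀ S, TaitGraph.IsComponent (κ.tait.restrict (κ.edgesOf σ)) S →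
      κ.SingleSigned {c | ∃ r ∈ S, (κ.tait.restrict (κ.edgesOf σ)).Inc c r}) ∧
    ∀ F, κ.IsFace (κ.edgesOf σ) F → κ.SingleSigned (κ.edgesInside (κ.edgesOf σ) F) := by
  rw [components_singleSigned_iff, faces_singleSigned_iff]
  have hB : ∀ c, σ c ≠ .A → σ c = .B := fun c => by cases σ c <;> simp
  constructor
  · intro h
    have h' : ∀ c c', D.segmentRegion σ c = D.segmentRegion σ c' → σ c = .A → σ c' = .A := by
      intro c c' heq hA
      by_contra hA'
      exact h ⟨_, c, c', heq, rfl, hA, hB c' hA'⟩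
    exact ⟨fun c _ c' _ => h' c c', fun c _ c' _ => h' c c'⟩
  · rintro ⟨h1, h2⟩ ⟨_, c, c', rfl, heq, hA, hB'⟩
    suffices σ c' = .A by rw [this] at hB'; cases hB'
    -- Segments in one complementary region have channels of one colour, so no comparison mixes
    -- `E_σ` with its complement.
    have hcolor : c ∈ κ.edgesOf σ ↔ c' ∈ κ.edgesOf σ := by
      constructor
      · intro hc
        exact mem_edgesOf.2
          ((conn_of_complementaryRegion_eq (mem_edgesOf.1 hc) heq.symm).black_iff.1
            (mem_edgesOf.1 hc))
      · intro hc
        exact mem_edgesOf.2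
          ((conn_of_complementaryRegion_eq (mem_edgesOf.1 hc) heq).black_iff.1
            (mem_edgesOf.1 hc))
    by_cases hc : c ∈ κ.edgesOf σ
    · exact h1 c hc c' (hcolor.1 hc) heq.symm hA
    · exact h2 c hc c' (mt hcolor.2 hc) heq.symm hA

end Coloring

end ConnectedLinkDiagram

/-! ### The characterization of homogeneous adequacy. -/

theorem theorem1p5 {C : Type*} [Nonempty C] (D : ConnectedLinkDiagram C) (hD : D.IsReduced)
    (κ : D.Coloring) (w : D.Region) (hw : κ.IsUnboundedFace w) (σ : D.State) :
    D.IsHomogeneouslyAdequate σ ↔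
      -- every edge of `E_σ` is contained in a cycle of `G|E_σ`
      (∀ c ∈ κ.edgesOf σ, TaitGraph.InCycle (κ.tait.restrict (κ.edgesOf σ)) c) ∧
      -- no edge outside `E_σ` has both endpoints on a connected component of `G|E_σ`
      (∀ c ∉ κ.edgesOf σ, ∀ S, TaitGraph.IsComponent (κ.tait.restrict (κ.edgesOf σ)) S →
        ¬ ∀ r, κ.tait.Inc c r → r ∈ S) ∧
      -- each connected component of `G|E_σ` is single-signed
      (∀ S, TaitGraph.IsComponent (κ.tait.restrict (κ.edgesOf σ)) S →
        κ.SingleSigned {c | ∃ r ∈ S, (κ.tait.restrict (κ.edgesOf σ)).Inc c r}) ∧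
      -- the edges outside `E_σ` inside a fundamental cycle of `G|E_σ`, that is, in a bounded face
      -- of `G|E_σ`, are single-signed
      (∀ F, κ.IsFace (κ.edgesOf σ) F → w ∉ F →
        κ.SingleSigned (κ.edgesInside (κ.edgesOf σ) F)) ∧
      -- the edges outside `E_σ` in the unbounded face of `G|E_σ` are single-signed
      (∀ F, κ.IsFace (κ.edgesOf σ) F → w ∈ F →
        κ.SingleSigned (κ.edgesInside (κ.edgesOf σ) F)) := by
  rw [ConnectedLinkDiagram.IsHomogeneouslyAdequate, κ.isAdequate_iff, κ.isHomogeneous_iff, and_assoc]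
  refine and_congr_right fun _ => and_congr_right fun _ => and_congr_right fun _ => ?_
  -- The last two conditions together range over all faces, split by whether the face contains `w`.
  refine ⟨fun h => ⟨fun F hF _ => h F hF, fun F hF _ => h F hF⟩, fun h F hF => ?_⟩
  by_cases hwF : w ∈ F
  · exact h.2 F hF hwF
  · exact h.1 F hF hwF
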